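/- Let $\mathbb{D}=\{z\in\mathbb{C}:|z|<1\}$, let $dA$ be the normalized area measure on $\mathbb{D}$, and let $L^2_a(\mathbb{D})$ be the Bergman space, i.e. the closed subspace of $L^2(\mathbb{D},dA)$ consisting of the functions that are analytic on $\mathbb{D}$. Let $P$ be the orthogonal projection of $L^2(\mathbb{D},dA)$ onto $L^2_a(\mathbb{D})$, and for $\phi\in L^\infty(\mathbb{D})$ let $T_\phi f=P(\phi f)$ $(f\in L^2_a(\mathbb{D}))$ be the Toeplitz operator with symbol $\phi$. Let $\widetilde\phi(z)=\langle T_\phi k_z,k_z\rangle$ $(z\in\mathbb{D})$ be the Berezin transform of $\phi$, where $k_z=K_z/\|K_z\|$ and $K_z(w)=(1-\bar z w)^{-2}$. Theorem. Let $\phi=cg+d\overline{g}$, where $g$ is a bounded analytic function on $\mathbb{D}$ and $c,d\in\mathbb{C}$. Then $\widetilde\phi(z)=\phi(z)$ for all $z\in\mathbb{D}$, in particular $\inf_{z\in\mathbb{D}}|\widetilde\phi(z)|=\inf_{z\in\mathbb{D}}|\phi(z)|$, and the following are equivalent: 1. $T_\phi$ is invertible as a bounded linear operator on $L^2_a(\mathbb{D})$;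 2. there exists $\delta>0$ such that $|\phi(z)|\ge\delta$ for all $z\in\mathbb{D}$; 3. $\inf_{z\in\mathbb{D}}|\phi(z)|>0$; 4. $\inf_{z\in\mathbb{D}}|\widetilde\phi(z)|>0$. -/

import Mathlib

open MeasureTheory Metric Set Filter Topology
open scoped ENNReal ComplexConjugate InnerProductSpace

/-- The open unit disc in the complex plane. -/
def disc : Set ℂ := ball (0 : ℂ) 1

/-- The normalized Lebesgue area measure `dA` on the unit disc, as a measure on `ℂ` carried by
the disc. -/
noncomputable def areaMeasure : Measure ℂ :=
  (ENNReal.ofReal Real.pi)⁻¹ • (volume : Measure ℂ).restrict disc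

theorem areaMeasure_disc : areaMeasure disc = 1 := by
  simp only [areaMeasure, Measure.smul_apply, disc, smul_eq_mul]
  rw [Measure.restrict_apply_self, Complex.volume_ball]
  simp only [ENNReal.ofReal_one, one_pow, one_mul]
  have h : ENNReal.ofReal Real.pi = (NNReal.pi : ℝ≥0∞) := by
    rw [← NNReal.coe_real_pi, ENNReal.ofReal_coe_nnreal]
  rw [h]
  exact ENNReal.inv_mul_cancel (by exact_mod_cast NNReal.pi_ne_zero) (by simp)

theorem ae_areaMeasure_mem_disc : ∀ᵐ z ∂areaMeasure, z ∈ disc :=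
  Measure.ae_smul_measure (ae_restrict_mem isOpen_ball.measurableSet) _

instance instIsProbabilityMeasureAreaMeasure : IsProbabilityMeasure areaMeasure where
  measure_univ := by
    rw [← areaMeasure_disc]
    exact (measure_congr (eventuallyEq_univ.2 ae_areaMeasure_mem_disc)).symm

/-- `g ∈ H^∞(𝔻)`: the function `g` is analytic and bounded on the unit disc. Its values off the
disc play no role. -/
def IsHInfty (g : ℂ → ℂ) : Prop :=
  DifferentiableOn ℂ g disc ∧ ∃ M : ℝ, ∀ z ∈ disc, ‖g z‖ ≤ M

/-- Bounded functions that are continuous on the disc are in `L^p(𝔻, dA)`. -/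
theorem memLp_of_continuousOn_disc {p : ℝ≥0∞} {f : ℂ → ℂ} (hf : ContinuousOn f disc) {M : ℝ}
    (hM : ∀ z ∈ disc, ‖f z‖ ≤ M) : MemLp f p areaMeasure := by
  refine MemLp.of_bound ?_ M ?_
  · exact (hf.aestronglyMeasurable isOpen_ball.measurableSet).smul_measure _
  · filter_upwards [ae_areaMeasure_mem_disc] with z hz using hM z hz

/-- The symbol `c g + d ḡ`. -/
noncomputable def symbol (g : ℂ → ℂ) (c d : ℂ) : ℂ → ℂ :=
  fun z => c * g z + d * conj (g z)

/-- For `g ∈ H^∞(𝔻)` the function `c g + d ḡ` is in `L^∞(𝔻)`. -/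
theorem IsHInfty.memLp_symbol {g : ℂ → ℂ} (hg : IsHInfty g) (c d : ℂ) :
    MemLp (symbol g c d) ∞ areaMeasure := by
  obtain ⟨hd, M, hM⟩ := hg
  have hc := hd.continuousOn
  refine memLp_of_continuousOn_disc (M := ‖c‖ * M + ‖d‖ * M) ?_ ?_
  · exact (continuousOn_const.mul hc).add
      (continuousOn_const.mul (Complex.continuous_conj.comp_continuousOn hc))
  · intro z hz
    unfold symbol
    refine (norm_add_le _ _).trans ?_
    rw [norm_mul, norm_mul, RCLike.norm_conj]
    have := hM z hz
    gcongr

/-! ### The Bergman space -/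

/-- The Bergman space `L²_a(𝔻)`: the classes in `L²(𝔻, dA)` that have a representative analytic
on the disc. -/
noncomputable def bergmanSpace : Submodule ℂ (Lp ℂ 2 areaMeasure) where
  carrier := {f | ∃ F : ℂ → ℂ, DifferentiableOn ℂ F disc ∧ f =ᵐ[areaMeasure] F}
  zero_mem' := ⟨0, differentiableOn_const 0, Lp.coeFn_zero _ _ _⟩
  add_mem' := by
    rintro f₁ f₂ ⟨F₁, h₁, e₁⟩ ⟨F₂, h₂, e₂⟩
    exact ⟨F₁ + F₂, h₁.add h₂, (Lp.coeFn_add f₁ f₂).trans (e₁.add e₂)⟩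
  smul_mem' := by
    rintro c f ⟨F, h, e⟩
    exact ⟨c • F, h.const_smul c, (Lp.coeFn_smul c f).trans (e.const_smul c)⟩

theorem enorm_le_lintegral_circle {F : ℂ → ℂ} {z : ℂ} {r s : ℝ}
    (hF : DifferentiableOn ℂ F (ball z r)) (hs : 0 < s) (hsr : s < r) :
    ENNReal.ofReal (2 * Real.pi) * ‖F z‖ₑ ≤
      ∫⁻ θ in Ioo (-Real.pi) Real.pi, ‖F (circleMap z s θ)‖ₑ := by
  have h1 : Real.circleAverage F z s = F z := by
    apply DiffContOnCl.circleAverage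
    rw [abs_of_pos hs]
    exact hF.diffContOnCl_ball (closedBall_subset_ball hsr)
  rw [Real.circleAverage_eq_integral_add (-Real.pi),
    intervalIntegral.integral_comp_add_right (fun θ => F (circleMap z s θ)),
    show 0 + -Real.pi = -Real.pi by ring, show 2 * Real.pi + -Real.pi = Real.pi by ring,
    intervalIntegral.integral_of_le (by linarith [Real.pi_pos]), integral_Ioc_eq_integral_Ioo] at h1
  have h2 : (2 * Real.pi) • F z = ∫ θ in Ioo (-Real.pi) Real.pi, F (circleMap z s θ) := by
    rw [← h1, smul_smul, mul_inv_cancel₀ (by positivity), one_smul]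
  calc ENNReal.ofReal (2 * Real.pi) * ‖F z‖ₑ = ‖(2 * Real.pi) • F z‖ₑ := by
        rw [enorm_smul, Real.enorm_eq_ofReal (by positivity)]
    _ ≤ _ := by rw [h2]; exact enorm_integral_le_lintegral_enorm _

theorem enorm_le_lintegral_ball {F : ℂ → ℂ} {z : ℂ} {r : ℝ} (hr : 0 < r)
    (hF : DifferentiableOn ℂ F (ball z r)) :
    ENNReal.ofReal (Real.pi * r ^ 2) * ‖F z‖ₑ ≤ ∫⁻ w in ball z r, ‖F w‖ₑ := by
  set H : ℂ → ℝ≥0∞ := (ball z r).indicator (fun w => ‖F w‖ₑ) with hH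
  have hHm : Measurable H := by
    have : H = fun w => ‖(ball z r).indicator F w‖ₑ := by
      ext w; rw [enorm_indicator_eq_indicator_enorm]
    rw [this]
    refine Measurable.enorm ?_
    classical
    rw [← Set.piecewise_eq_indicator]
    exact hF.continuousOn.measurable_piecewise continuousOn_const measurableSet_ball
  have hpm : Measurable fun p : ℝ × ℝ =>
      ENNReal.ofReal p.1 * H (z + Complex.polarCoord.symm p) := by
    simp only [Complex.polarCoord_symm_apply]
    refine Measurable.mul (by fun_prop) (hHm.comp ?_)
    exact Continuous.measurable (by fun_prop)
  rw [← lintegral_indicator measurableSet_ball, ← hH, ← lintegral_add_left_eq_self H z,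
    ← Complex.lintegral_comp_polarCoord_symm]
  have hsub : Ioo (0 : ℝ) r ×ˢ Ioo (-Real.pi) Real.pi ⊆ polarCoord.target := by
    rw [polarCoord_target]
    exact prod_mono Ioo_subset_Ioi_self subset_rfl
  refine le_trans ?_ (lintegral_mono_set hsub)
  simp only [smul_eq_mul]
  rw [Measure.volume_eq_prod, ← Measure.prod_restrict, lintegral_prod _ hpm.aemeasurable]
  have key : ∀ s ∈ Ioo (0 : ℝ) r, ENNReal.ofReal s * (ENNReal.ofReal (2 * Real.pi) * ‖F z‖ₑ) ≤
      ∫⁻ θ in Ioo (-Real.pi) Real.pi,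
        ENNReal.ofReal s * H (z + Complex.polarCoord.symm (s, θ)) := by
    intro s hs
    rw [lintegral_const_mul' _ _ ENNReal.ofReal_ne_top]
    gcongr
    refine (enorm_le_lintegral_circle hF hs.1 hs.2).trans (le_of_eq ?_)
    congr 1
    ext θ
    have e : z + Complex.polarCoord.symm (s, θ) = circleMap z s θ := by
      rw [Complex.polarCoord_symm_apply, circleMap, Complex.exp_mul_I]
      push_cast; ring
    have hm : circleMap z s θ ∈ ball z r := by
      rw [mem_ball, dist_eq_norm, circleMap_sub_center, norm_circleMap_zero, abs_of_pos hs.1]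
      exact hs.2
    rw [e, hH, indicator_of_mem hm]
  refine le_trans ?_ (setLIntegral_mono' measurableSet_Ioo key)
  rw [lintegral_mul_const _ (by fun_prop), ← mul_assoc]
  gcongr
  rw [← ofReal_integral_eq_lintegral_ofReal, ← integral_Ioc_eq_integral_Ioo,
    ← intervalIntegral.integral_of_le hr.le, integral_id, ← ENNReal.ofReal_mul]
  · apply ENNReal.ofReal_le_ofReal
    nlinarith
  · nlinarith [sq_nonneg r]
  · exact (continuous_id.integrableOn_Icc (a := 0) (b := r)).mono_set Ioo_subset_Icc_self
  · filter_upwards [ae_restrict_mem measurableSet_Ioo] with s hs using hs.1.le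

/-- Point evaluations are bounded on the Bergman space. -/
theorem bergman_eval_bound {F : ℂ → ℂ} (hF : DifferentiableOn ℂ F disc)
    {f : Lp ℂ 2 areaMeasure} (hf : f =ᵐ[areaMeasure] F) {z : ℂ} {r : ℝ} (hr : 0 < r)
    (hz : ball z r ⊆ disc) : r * ‖F z‖ ≤ ‖f‖ := by
  have h1 := enorm_le_lintegral_ball hr ((hF.mono hz).pow 2)
  have hpi : ENNReal.ofReal Real.pi ≠ 0 := by
    simpa using Real.pi_pos
  have h2 : ∫⁻ w in disc, ‖F w ^ 2‖ₑ = ENNReal.ofReal Real.pi * ‖f‖ₑ ^ 2 := by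
    have e : ‖f‖ₑ ^ 2 = ∫⁻ w, ‖F w‖ₑ ^ 2 ∂areaMeasure := by
      rw [Lp.enorm_def, eLpNorm_congr_ae hf]
      have := eLpNorm_nnreal_pow_eq_lintegral (p := 2) (f := F) (μ := areaMeasure) (by norm_num)
      simpa using this
    rw [e, areaMeasure, lintegral_smul_measure, smul_eq_mul, ← mul_assoc,
      ENNReal.mul_inv_cancel hpi ENNReal.ofReal_ne_top, one_mul]
    simp [enorm_pow]
  have h3 : ENNReal.ofReal (Real.pi * r ^ 2) * ‖F z ^ 2‖ₑ ≤ ENNReal.ofReal Real.pi * ‖f‖ₑ ^ 2 := by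
    rw [← h2]
    exact h1.trans (lintegral_mono_set hz)
  rw [enorm_pow, ← ofReal_norm, ← ofReal_norm,
    ← ENNReal.ofReal_pow (norm_nonneg _), ← ENNReal.ofReal_pow (norm_nonneg _),
    ← ENNReal.ofReal_mul (by positivity), ← ENNReal.ofReal_mul (by positivity),
    ENNReal.ofReal_le_ofReal_iff (by positivity)] at h3
  have h4 : (r * ‖F z‖) ^ 2 ≤ ‖f‖ ^ 2 := by
    have : Real.pi * (r * ‖F z‖) ^ 2 ≤ Real.pi * ‖f‖ ^ 2 := by linarith [h3]
    exact le_of_mul_le_mul_left this Real.pi_pos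
  exact (pow_le_pow_iff_left₀ (by positivity) (norm_nonneg _) two_ne_zero).1 h4

theorem isClosed_bergmanSpace : IsClosed (bergmanSpace : Set (Lp ℂ 2 areaMeasure)) := by
  refine IsSeqClosed.isClosed fun f f₀ hf hlim => ?_
  choose F hFd hFe using hf
  have hcau : ∀ ε > 0, ∃ N, ∀ m ≥ N, ∀ n ≥ N, ‖f m - f n‖ < ε := by
    intro ε hε
    obtain ⟨N, hN⟩ := Metric.cauchySeq_iff.1 hlim.cauchySeq ε hε
    exact ⟨N, fun m hm n hn => by simpa [dist_eq_norm] using hN m hm n hn⟩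
  have hbd : ∀ m n : ℕ, ∀ (z : ℂ) (r : ℝ), 0 < r → ball z r ⊆ disc →
      r * ‖F m z - F n z‖ ≤ ‖f m - f n‖ := fun m n z r hr hz =>
    bergman_eval_bound (F := F m - F n) ((hFd m).sub (hFd n))
      ((Lp.coeFn_sub _ _).trans ((hFe m).sub (hFe n))) hr hz
  have hunif : ∀ (S : Set ℂ) (r : ℝ), 0 < r → (∀ z ∈ S, ball z r ⊆ disc) →
      UniformCauchySeqOn F atTop S := by
    intro S r hr hS
    rw [Metric.uniformCauchySeqOn_iff]
    intro ε hε
    obtain ⟨N, hN⟩ := hcau (r * ε) (by positivity)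
    refine ⟨N, fun m hm n hn z hz => ?_⟩
    rw [dist_eq_norm]
    exact lt_of_mul_lt_mul_left ((hbd m n z r hr (hS z hz)).trans_lt (hN m hm n hn)) hr.le
  have hrad : ∀ x ∈ disc, 0 < (1 - ‖x‖) / 2 ∧
      ∀ z ∈ ball x ((1 - ‖x‖) / 2), ball z ((1 - ‖x‖) / 2) ⊆ disc := by
    intro x hx
    have hx' : ‖x‖ < 1 := by simpa [disc] using hx
    refine ⟨by linarith, fun z hz => ?_⟩
    refine ball_subset_ball' ?_
    have h1 : dist z x < (1 - ‖x‖) / 2 := hz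
    have h2 : dist z 0 ≤ dist z x + dist x 0 := dist_triangle _ _ _
    rw [dist_zero_right x] at h2
    linarith
  have hpt : ∀ x ∈ disc, ∃ l, Tendsto (fun n => F n x) atTop (𝓝 l) := by
    intro x hx
    obtain ⟨hr, hb⟩ := hrad x hx
    exact cauchySeq_tendsto_of_complete
      ((hunif _ _ hr hb).cauchySeq (mem_ball_self hr))
  classical
  choose! G hG using hpt
  have hloc : TendstoLocallyUniformlyOn F G atTop disc := by
    rw [Metric.tendstoLocallyUniformlyOn_iff]
    intro ε hε x hx
    obtain ⟨hr, hb⟩ := hrad x hx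
    have hS : ball x ((1 - ‖x‖) / 2) ⊆ disc := fun z hz => hb z hz (mem_ball_self hr)
    refine ⟨_, mem_nhdsWithin_of_mem_nhds (ball_mem_nhds x hr), ?_⟩
    exact Metric.tendstoUniformlyOn_iff.1
      ((hunif _ _ hr hb).tendstoUniformlyOn_of_tendsto fun z hz => hG z (hS hz)) ε hε
  refine ⟨G, hloc.differentiableOn (Eventually.of_forall hFd) isOpen_ball, ?_⟩
  obtain ⟨ns, hns, hae⟩ := (tendstoInMeasure_of_tendsto_Lp hlim).exists_seq_tendsto_ae
  have hall : ∀ᵐ z ∂areaMeasure, ∀ n, f n z = F n z := ae_all_iff.2 hFe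
  filter_upwards [hae, hall, ae_areaMeasure_mem_disc] with z h1 h2 h3
  refine tendsto_nhds_unique h1 ?_
  simp only [h2]
  exact (hG z h3).comp hns.tendsto_atTop

instance instCompleteSpaceBergmanSpace : CompleteSpace bergmanSpace :=
  isClosed_bergmanSpace.completeSpace_coe

/-! ### Toeplitz operators and the Berezin transform -/

/-- The Bergman Toeplitz operator `T_φ f = P (φ f)` with symbol `φ ∈ L^∞(𝔻)`, where `P` is the
orthogonal projection of `L²(𝔻, dA)` onto the Bergman space. -/
noncomputable def toeplitz (φ : Lp ℂ ∞ areaMeasure) : bergmanSpace →L[ℂ] bergmanSpace :=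
  bergmanSpace.orthogonalProjectionOnto ∘L
    ((ContinuousLinearMap.mul ℂ ℂ).holderL areaMeasure ∞ 2 2 φ) ∘L bergmanSpace.subtypeL

theorem one_sub_norm_le_norm_one_sub (z : ℂ) {w : ℂ} (hw : w ∈ disc) :
    1 - ‖z‖ ≤ ‖1 - conj z * w‖ := by
  have hw' : ‖w‖ < 1 := by simpa [disc] using hw
  have h1 : ‖(1 : ℂ)‖ - ‖conj z * w‖ ≤ ‖1 - conj z * w‖ := norm_sub_norm_le _ _
  rw [norm_one, norm_mul, RCLike.norm_conj] at h1
  nlinarith [norm_nonneg z, norm_nonneg w]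

theorem differentiableOn_bergmanKernel {z : ℂ} (hz : z ∈ disc) :
    DifferentiableOn ℂ (fun w : ℂ => 1 / (1 - conj z * w) ^ 2) disc := by
  have hz' : ‖z‖ < 1 := by simpa [disc] using hz
  refine DifferentiableOn.div (by fun_prop) (by fun_prop) fun w hw => ?_
  refine pow_ne_zero 2 (norm_pos_iff.1 ?_)
  linarith [one_sub_norm_le_norm_one_sub z hw]

theorem memLp_bergmanKernel {z : ℂ} (hz : z ∈ disc) :
    MemLp (fun w : ℂ => 1 / (1 - conj z * w) ^ 2) 2 areaMeasure := by
  have hz' : ‖z‖ < 1 := by simpa [disc] using hz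
  refine memLp_of_continuousOn_disc (M := 1 / (1 - ‖z‖) ^ 2)
    (differentiableOn_bergmanKernel hz).continuousOn fun w hw => ?_
  have := one_sub_norm_le_norm_one_sub z hw
  have h0 : 0 < 1 - ‖z‖ := by linarith
  rw [norm_div, norm_one, norm_pow]
  gcongr

/-- The reproducing kernel `K_z(w) = 1 / (1 - z̄ w)²` of the Bergman space at a point `z` of the
disc, as an element of that space. -/
noncomputable def bergmanKernel (z : disc) : bergmanSpace :=
  ⟨(memLp_bergmanKernel z.2).toLp _,
    _, differentiableOn_bergmanKernel z.2, MemLp.coeFn_toLp _⟩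

/-- The normalized reproducing kernel `k_z = K_z / ‖K_z‖`. -/
noncomputable def normalizedKernel (z : disc) : bergmanSpace :=
  ((‖bergmanKernel z‖⁻¹ : ℝ) : ℂ) • bergmanKernel z

/-- The Berezin transform `φ̃(z) = ⟨T_φ k_z, k_z⟩` of `φ ∈ L^∞(𝔻)`. The inner product of Mathlib
is linear in its second argument, hence the order of the arguments. -/
noncomputable def berezin (φ : Lp ℂ ∞ areaMeasure) (z : disc) : ℂ :=
  ⟪normalizedKernel z, toeplitz φ (normalizedKernel z)⟫_ℂ

/-! ### The reproducing property -/

/-! Since `g` is analytic, `T_g` is multiplication by `g`, and T_φ = c T_g + d T_g*. The reproducing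
property gives ⟨T_g k_z, k_z⟩ = g(z), so the Berezin transform of φ is φ.

For |d| < |c| the key is T_g* = C T_g with C = T_{ḡ/g} a contraction
(`exists_adjoint_analyticToeplitz_eq`). Then T_φ = c (1 + (d/c) C) T_g with an invertible left
factor, so T_φ is invertible iff T_g is. A lower bound on |φ| gives one on |g|, and T_{1/g} then
inverts T_g. For |d| = |c| a rotation makes φ real; if |φ| is bounded below, φ has constant sign on
the connected disc and a Neumann series inverts T_φ. The case |d| > |c| follows by taking adjoints.

Conversely, let T_φ be invertible, |d| ≤ |c|, and suppose |φ(z)| is tiny. Put a = g(z). Replacing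
`g` by g - a moves T_φ by the scalar φ(z), and replacing c by (1+η)c moves it little, so the new
operator is still invertible. Now the strict case applies and T_{g-a} is invertible, although g - a
vanishes at z. -/

theorem integral_areaMeasure_eq_integral_circleAverage {f : ℂ → ℂ} (hf : ContinuousOn f disc)
    {M : ℝ} (hM : ∀ z ∈ disc, ‖f z‖ ≤ M) :
    ∫ w, f w ∂areaMeasure = ∫ r in (0 : ℝ)..1, (2 * r) • Real.circleAverage f 0 r := by
  have hmeas : Measurable (disc.indicator f) := by
    classical
    rw [← Set.piecewise_eq_indicator]
    exact hf.measurable_piecewise continuousOn_const measurableSet_ball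
  have hbound : ∀ z, ‖disc.indicator f z‖ ≤ M := by
    intro z
    by_cases hz : z ∈ disc
    · rw [indicator_of_mem hz]; exact hM z hz
    · rw [indicator_of_notMem hz, norm_zero]
      exact (norm_nonneg _).trans (hM 0 (mem_ball_self one_pos))
  have hpolar : ∀ r θ : ℝ, Complex.polarCoord.symm (r, θ) = circleMap 0 r θ := by
    intro r θ
    rw [Complex.polarCoord_symm_apply, circleMap, Complex.exp_mul_I]
    push_cast; ring
  have hpolar' : ⇑Complex.polarCoord.symm =
      fun p : ℝ × ℝ => (p.1 : ℂ) * (Real.cos p.2 + Real.sin p.2 * Complex.I) :=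
    funext Complex.polarCoord_symm_apply
  have hmem : ∀ r ∈ Ioo (0 : ℝ) 1, ∀ θ, circleMap 0 r θ ∈ disc := by
    intro r hr θ
    rw [disc, mem_ball_zero_iff, norm_circleMap_zero, abs_of_pos hr.1]
    exact hr.2
  set h : ℝ × ℝ → ℂ := fun p => p.1 • disc.indicator f (Complex.polarCoord.symm p) with hh
  -- The polar chart covers all radii r > 0; the indicator of the disc cuts them to r < 1.
  have hset : ∫ p in polarCoord.target, h p =
      ∫ p in Ioo (0 : ℝ) 1 ×ˢ Ioo (-Real.pi) Real.pi, h p := by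
    rw [polarCoord_target]
    refine setIntegral_eq_of_subset_of_forall_sdiff_eq_zero
      (measurableSet_Ioi.prod measurableSet_Ioo) (prod_mono Ioo_subset_Ioi_self subset_rfl) ?_
    rintro ⟨r, θ⟩ ⟨⟨hr, hθ⟩, hn⟩
    have h1 : ¬ r < 1 := fun h => hn ⟨⟨hr, h⟩, hθ⟩
    have h2 : Complex.polarCoord.symm (r, θ) ∉ disc := by
      rw [hpolar, disc, mem_ball_zero_iff, norm_circleMap_zero, abs_of_pos hr]
      exact h1
    simp only [hh]
    rw [indicator_of_notMem h2, smul_zero]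
  have hint : IntegrableOn h (Ioo (0 : ℝ) 1 ×ˢ Ioo (-Real.pi) Real.pi) := by
    refine Measure.integrableOn_of_bounded (M := M) ?_ ?_ ?_
    · rw [Measure.volume_eq_prod, Measure.prod_prod]
      simp
    · refine Measurable.aestronglyMeasurable ?_
      refine Measurable.smul measurable_fst (hmeas.comp ?_)
      refine Continuous.measurable ?_
      simp only [hpolar']
      fun_prop
    · filter_upwards [ae_restrict_mem (measurableSet_Ioo.prod measurableSet_Ioo)] with p hp
      rw [hh, norm_smul, Real.norm_of_nonneg hp.1.1.le]
      exact (mul_le_of_le_one_left (norm_nonneg _) hp.1.2.le).trans (hbound _)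
  rw [areaMeasure, integral_smul_measure, 
    ← integral_indicator (show MeasurableSet disc from measurableSet_ball),
    ← Complex.integral_comp_polarCoord_symm, hset, Measure.volume_eq_prod,
    setIntegral_prod _ (by rwa [Measure.volume_eq_prod] at hint),
    intervalIntegral.integral_of_le zero_le_one, integral_Ioc_eq_integral_Ioo, ← integral_smul]
  refine setIntegral_congr_fun measurableSet_Ioo fun r hr => ?_
  -- Polar coordinates use angles in (-π, π), so the period of the circle average is shifted to
  -- match.
  rw [Real.circleAverage_eq_integral_add (-Real.pi),
    intervalIntegral.integral_comp_add_right (fun θ => f (circleMap 0 r θ)),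
    show 0 + -Real.pi = -Real.pi by ring, show 2 * Real.pi + -Real.pi = Real.pi by ring,
    intervalIntegral.integral_of_le (by linarith [Real.pi_pos]), integral_Ioc_eq_integral_Ioo]
  have : ∀ θ, h (r, θ) = r • f (circleMap 0 r θ) := by
    intro θ
    simp only [hh]
    rw [hpolar, indicator_of_mem (hmem r hr θ)]
  simp only [this, integral_smul, smul_smul]
  congr 1
  rw [ENNReal.toReal_inv, ENNReal.toReal_ofReal Real.pi_pos.le]
  field_simp

/-- On |w| = r one has w̄ = r²/w, so the conjugated kernel equals w²/(w - z r²)². With dw/(2πi w) as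
averaging measure this becomes Cauchy's formula for the derivative of w F(w) at z r². -/
theorem circleAverage_conj_bergmanKernel_mul {F : ℂ → ℂ} (hF : DifferentiableOn ℂ F disc) {z : ℂ}
    (hz : z ∈ disc) {r : ℝ} (hr : r ∈ Ioo (0 : ℝ) 1) :
    Real.circleAverage (fun w => conj (1 / (1 - conj z * w) ^ 2) * F w) 0 r =
      deriv (fun w => w * F w) (z * r ^ 2) := by
  have hz' : ‖z‖ < 1 := by simpa [disc] using hz
  have hG : DifferentiableOn ℂ (fun w => w * F w) disc := differentiableOn_id.mul hF
  have hw₀ : z * (r : ℂ) ^ 2 ∈ ball (0 : ℂ) r := by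
    rw [mem_ball_zero_iff, norm_mul, norm_pow, Complex.norm_real, Real.norm_of_nonneg hr.1.le]
    nlinarith [hr.1, hr.2, norm_nonneg z, mul_pos hr.1 hr.1]
  have hsub : closedBall (0 : ℂ) r ⊆ disc := closedBall_subset_ball hr.2
  rw [← Complex.two_pi_I_inv_smul_circleIntegral_sub_sq_inv_smul_of_differentiable isOpen_ball
    hsub hG hw₀, Real.circleAverage_eq_circleIntegral hr.1.ne']
  congr 1
  refine circleIntegral.integral_congr hr.1.le fun w hw => ?_
  have hwr : ‖w‖ = r := by simpa using hw
  have hw0 : w ≠ 0 := by rw [← norm_pos_iff, hwr]; exact hr.1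
  have hww : conj w * w = (r : ℂ) ^ 2 := by
    rw [← hwr, mul_comm, Complex.mul_conj']
  have h1 : w - z * (r : ℂ) ^ 2 = w * (1 - z * conj w) := by rw [← hww]; ring
  simp only [sub_zero, smul_eq_mul, map_div₀, map_one, map_pow, map_sub, map_mul,
    Complex.conj_conj, h1]
  have h2 : (1 - z * conj w) ≠ 0 := by
    have := one_sub_norm_le_norm_one_sub (conj z) (w := conj w)
      (by rw [disc, mem_ball_zero_iff, RCLike.norm_conj, hwr]; exact hr.2)
    rw [Complex.conj_conj, RCLike.norm_conj] at this
    exact norm_pos_iff.1 (by linarith)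
  field_simp

/-- The reproducing property of the Bergman kernel, for bounded analytic functions. -/
theorem integral_conj_bergmanKernel_mul {F : ℂ → ℂ} (hF : IsHInfty F) {z : ℂ} (hz : z ∈ disc) :
    ∫ w, conj (1 / (1 - conj z * w) ^ 2) * F w ∂areaMeasure = F z := by
  obtain ⟨hFd, M, hM⟩ := hF
  have hz' : ‖z‖ < 1 := by simpa [disc] using hz
  have hG : DifferentiableOn ℂ (fun w => w * F w) disc := differentiableOn_id.mul hFd
  have hcont : ContinuousOn (fun w => conj (1 / (1 - conj z * w) ^ 2) * F w) disc :=
    (Complex.continuous_conj.comp_continuousOn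
      (differentiableOn_bergmanKernel hz).continuousOn).mul hFd.continuousOn
  have hbound : ∀ w ∈ disc,
      ‖conj (1 / (1 - conj z * w) ^ 2) * F w‖ ≤ 1 / (1 - ‖z‖) ^ 2 * M := by
    intro w hw
    have h1 := one_sub_norm_le_norm_one_sub z hw
    have h2 := hM w hw
    have h0 : 0 < 1 - ‖z‖ := by linarith
    rw [norm_mul, RCLike.norm_conj, norm_div, norm_one, norm_pow]
    gcongr
  rw [integral_areaMeasure_eq_integral_circleAverage hcont hbound]
  have hmem : ∀ r ∈ Icc (0 : ℝ) 1, z * (r : ℂ) ^ 2 ∈ disc := by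
    intro r hr
    rw [disc, mem_ball_zero_iff, norm_mul, norm_pow, Complex.norm_real, Real.norm_of_nonneg hr.1]
    exact (mul_le_of_le_one_right (norm_nonneg z) (pow_le_one₀ hr.1 hr.2)).trans_lt hz'
  have hcongr : ∫ r in (0 : ℝ)..1, (2 * r) • Real.circleAverage
        (fun w => conj (1 / (1 - conj z * w) ^ 2) * F w) 0 r =
      ∫ r in (0 : ℝ)..1, (2 * r) • deriv (fun w => w * F w) (z * r ^ 2) := by
    rw [intervalIntegral.integral_of_le zero_le_one, intervalIntegral.integral_of_le zero_le_one,
      integral_Ioc_eq_integral_Ioo, integral_Ioc_eq_integral_Ioo]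
    refine setIntegral_congr_fun measurableSet_Ioo fun r hr => ?_
    simp only [circleAverage_conj_bergmanKernel_mul hFd hz hr]
  -- This primitive is G(z r²)/z for G(w) = w F(w), written without the division so that z = 0 is
  -- covered. It runs from 0 to F(z).
  have hderiv : ∀ r ∈ uIcc (0 : ℝ) 1, HasDerivAt (fun r : ℝ => (r : ℂ) ^ 2 * F (z * r ^ 2))
      ((2 * r) • deriv (fun w => w * F w) (z * r ^ 2)) r := by
    intro r hr
    rw [uIcc_of_le zero_le_one] at hr
    have h1 : HasDerivAt F (deriv F (z * r ^ 2)) (z * r ^ 2) :=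
      (hFd.differentiableAt (isOpen_ball.mem_nhds (hmem r hr))).hasDerivAt
    have h2 : HasDerivAt (fun r : ℝ => (r : ℂ) ^ 2) (2 * r) r := by
      simpa using (hasDerivAt_id (r : ℂ)).pow 2 |>.comp_ofReal
    have h3 : HasDerivAt (fun r : ℝ => F (z * (r : ℂ) ^ 2)) _ r :=
      h1.comp r (h2.const_mul z)
    have h4 : deriv (fun w => w * F w) (z * r ^ 2) = _ := ((hasDerivAt_id _).mul h1).deriv
    refine (h2.mul h3).congr_deriv ?_
    rw [h4, Complex.real_smul]
    push_cast
    ring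
  rw [hcongr, intervalIntegral.integral_eq_sub_of_hasDerivAt hderiv]
  · simp
  · refine ContinuousOn.intervalIntegrable ?_
    rw [uIcc_of_le zero_le_one]
    have h1 : Continuous fun r : ℝ => 2 * r := by fun_prop
    have h2 : Continuous fun r : ℝ => z * (r : ℂ) ^ 2 := by fun_prop
    exact h1.continuousOn.smul
      ((hG.deriv isOpen_ball).continuousOn.comp h2.continuousOn hmem)

/-! ### Algebra of Toeplitz operators -/

theorem toeplitz_add (φ ψ : Lp ℂ ∞ areaMeasure) :
    toeplitz (φ + ψ) = toeplitz φ + toeplitz ψ := by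
  ext1 f
  simp [toeplitz]

theorem toeplitz_smul (c : ℂ) (φ : Lp ℂ ∞ areaMeasure) : toeplitz (c • φ) = c • toeplitz φ := by
  ext1 f
  simp [toeplitz]

theorem toeplitz_sub (φ ψ : Lp ℂ ∞ areaMeasure) :
    toeplitz (φ - ψ) = toeplitz φ - toeplitz ψ := by
  ext1 f
  simp [toeplitz]

theorem norm_toeplitz_le (φ : Lp ℂ ∞ areaMeasure) : ‖toeplitz φ‖ ≤ ‖φ‖ := by
  refine ContinuousLinearMap.opNorm_le_bound _ (norm_nonneg _) fun f => ?_
  refine (bergmanSpace.orthogonalProjectionOnto.le_of_opNorm_le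
    bergmanSpace.orthogonalProjectionOnto_norm_le _).trans ?_
  have h := (ContinuousLinearMap.mul ℂ ℂ).norm_holder_apply_apply_le (r := 2) φ
    (f : Lp ℂ 2 areaMeasure)
  have h1 : ‖ContinuousLinearMap.mul ℂ ℂ‖ ≤ 1 := ContinuousLinearMap.opNorm_mul_le ℂ ℂ
  rw [one_mul]
  refine h.trans ?_
  rw [mul_assoc]
  exact mul_le_of_le_one_left (by positivity) h1

/-- The projection can be dropped because `h` lies in its range; operator identities thus reduce to
pointwise identities of integrands. -/
theorem inner_toeplitz (φ : Lp ℂ ∞ areaMeasure) (h f : bergmanSpace) :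
    ⟪h, toeplitz φ f⟫_ℂ =
      ∫ w, conj ((h : Lp ℂ 2 areaMeasure) w) * (φ w * (f : Lp ℂ 2 areaMeasure) w)
        ∂areaMeasure := by
  have h1 : ⟪h, toeplitz φ f⟫_ℂ = ⟪(h : Lp ℂ 2 areaMeasure),
      (ContinuousLinearMap.mul ℂ ℂ).holder 2 φ (f : Lp ℂ 2 areaMeasure)⟫_ℂ :=
    Submodule.inner_orthogonalProjectionOnto_eq_of_mem_left _ _
  rw [h1, L2.inner_def]
  refine integral_congr_ae ?_
  filter_upwards [(ContinuousLinearMap.mul ℂ ℂ).coeFn_holder (r := 2) φ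
    (f : Lp ℂ 2 areaMeasure)] with w hw
  rw [hw, RCLike.inner_apply, ContinuousLinearMap.mul_apply', mul_comm]

/-- A Toeplitz operator with bounded analytic symbol is a multiplication operator. -/
theorem coeFn_toeplitz_of_analytic {g : ℂ → ℂ} (hg : DifferentiableOn ℂ g disc)
    {φ : Lp ℂ ∞ areaMeasure} (hφ : φ =ᵐ[areaMeasure] g) (f : bergmanSpace) :
    (toeplitz φ f : Lp ℂ 2 areaMeasure) =ᵐ[areaMeasure]
      fun w => g w * (f : Lp ℂ 2 areaMeasure) w := by
  have hae : (ContinuousLinearMap.mul ℂ ℂ).holder 2 φ (f : Lp ℂ 2 areaMeasure) =ᵐ[areaMeasure]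
      fun w => g w * (f : Lp ℂ 2 areaMeasure) w := by
    filter_upwards [(ContinuousLinearMap.mul ℂ ℂ).coeFn_holder (r := 2) φ
      (f : Lp ℂ 2 areaMeasure), hφ] with w hw h
    rw [hw, ContinuousLinearMap.mul_apply', h]
  have hmem : (ContinuousLinearMap.mul ℂ ℂ).holder 2 φ (f : Lp ℂ 2 areaMeasure)
      ∈ bergmanSpace := by
    obtain ⟨F, hF, hfF⟩ := f.2
    refine ⟨fun w => g w * F w, hg.mul hF, hae.trans ?_⟩
    filter_upwards [hfF] with w hw
    rw [hw]
  have hproj : (toeplitz φ f : Lp ℂ 2 areaMeasure) =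
      (ContinuousLinearMap.mul ℂ ℂ).holder 2 φ (f : Lp ℂ 2 areaMeasure) :=
    congrArg Subtype.val (Submodule.orthogonalProjectionOnto_mem_subspace_eq_self
      (⟨_, hmem⟩ : bergmanSpace))
  rw [hproj]
  exact hae

/-- The analytic factor must act first: it multiplies without projecting, so only the projection of
the outer factor remains. -/
theorem toeplitz_mul_toeplitz_of_analytic {g : ℂ → ℂ} (hg : DifferentiableOn ℂ g disc)
    {φ ψ χ : Lp ℂ ∞ areaMeasure} (hφ : φ =ᵐ[areaMeasure] g)
    (hχ : χ =ᵐ[areaMeasure] fun w => ψ w * g w) :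
    toeplitz ψ * toeplitz φ = toeplitz χ := by
  ext1 f
  refine ext_inner_left ℂ fun h => ?_
  rw [mul_apply_eq_comp, inner_toeplitz, inner_toeplitz]
  refine integral_congr_ae ?_
  filter_upwards [coeFn_toeplitz_of_analytic hg hφ f, hχ] with w h1 h2
  rw [h1, h2, mul_assoc]

theorem toeplitz_eq_one {φ : Lp ℂ ∞ areaMeasure} (hφ : φ =ᵐ[areaMeasure] fun _ => 1) :
    toeplitz φ = 1 := by
  ext1 f
  refine Subtype.ext (Lp.ext ?_)
  filter_upwards [coeFn_toeplitz_of_analytic (differentiableOn_const 1) hφ f] with w hw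
  rw [hw, one_mul, one_apply_eq_self]

theorem adjoint_toeplitz {φ ψ : Lp ℂ ∞ areaMeasure}
    (h : ψ =ᵐ[areaMeasure] fun w => conj (φ w)) :
    ContinuousLinearMap.adjoint (toeplitz φ) = toeplitz ψ := by
  ext1 f
  refine ext_inner_left ℂ fun k => ?_
  rw [ContinuousLinearMap.adjoint_inner_right, ← inner_conj_symm, inner_toeplitz, inner_toeplitz,
    ← integral_conj]
  refine integral_congr_ae ?_
  filter_upwards [h] with w hw
  rw [hw]
  simp only [map_mul, Complex.conj_conj]
  ring

theorem isUnit_smul_iff_of_ne_zero {R : Type*} [Ring R] [Algebra ℂ R] {c : ℂ} (hc : c ≠ 0)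
    {a : R} : IsUnit (c • a) ↔ IsUnit a :=
  isUnit_smul_iff (Units.mk0 c hc) a

/-- A Toeplitz operator whose symbol is real, bounded and bounded below by a positive constant is
invertible. -/
theorem isUnit_toeplitz_of_real {φ : Lp ℂ ∞ areaMeasure} {u : ℂ → ℝ} {m M : ℝ} (hm : 0 < m)
    (hφ : φ =ᵐ[areaMeasure] fun w => (u w : ℂ)) (hu : ∀ w ∈ disc, u w ∈ Icc m M) :
    IsUnit (toeplitz φ) := by
  have hM : 0 < M := hm.trans_le ((hu 0 (mem_ball_self one_pos)).1.trans
    (hu 0 (mem_ball_self one_pos)).2)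
  have hmM : m ≤ M := (hu 0 (mem_ball_self one_pos)).1.trans (hu 0 (mem_ball_self one_pos)).2
  set e : Lp ℂ ∞ areaMeasure := (memLp_const (1 : ℂ)).toLp _
  have he : e =ᵐ[areaMeasure] fun _ => (1 : ℂ) := MemLp.coeFn_toLp _
  have hM' : (M : ℂ)⁻¹ ≠ 0 := inv_ne_zero (by exact_mod_cast hM.ne')
  -- Scaling by 1/M puts the symbol in [m/M, 1], at distance less than 1 from the constant 1.
  have hbound : ‖e - (M : ℂ)⁻¹ • φ‖ ≤ 1 - m / M := by
    have h := Lp.norm_le_of_ae_bound (f := e - (M : ℂ)⁻¹ • φ)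
      (sub_nonneg.2 ((div_le_one hM).2 hmM)) ?_
    · simpa using h
    filter_upwards [Lp.coeFn_sub e ((M : ℂ)⁻¹ • φ), Lp.coeFn_smul (M : ℂ)⁻¹ φ, he, hφ,
      ae_areaMeasure_mem_disc] with w h1 h2 h3 h4 hw
    obtain ⟨h5, h6⟩ := hu w hw
    have h7 : (1 : ℂ) - (M : ℂ)⁻¹ * (u w : ℂ) = ((1 - u w / M : ℝ) : ℂ) := by
      push_cast
      ring
    rw [h1, Pi.sub_apply, h2, Pi.smul_apply, h3, h4, smul_eq_mul, h7, Complex.norm_real,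
      Real.norm_of_nonneg (sub_nonneg.2 ((div_le_one hM).2 h6))]
    gcongr
  have hnorm : ‖toeplitz (e - (M : ℂ)⁻¹ • φ)‖ < 1 :=
    (norm_toeplitz_le _).trans_lt (hbound.trans_lt (by linarith [div_pos hm hM]))
  have h := isUnit_one_sub_of_norm_lt_one (R := bergmanSpace →L[ℂ] bergmanSpace) hnorm
  rw [toeplitz_sub, toeplitz_smul, toeplitz_eq_one he, sub_sub_cancel] at h
  exact (isUnit_smul_iff_of_ne_zero hM').1 h

/-! ### Operators on a Hilbert space -/

theorem inner_normalized_eq {E : Type*} [NormedAddCommGroup E] [InnerProductSpace ℂ E]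
    {T : E →L[ℂ] E} {x : E} {a : ℂ} (hx : x ≠ 0) (h : ⟪x, T x⟫_ℂ = a * ⟪x, x⟫_ℂ) :
    ⟪((‖x‖⁻¹ : ℝ) : ℂ) • x, T (((‖x‖⁻¹ : ℝ) : ℂ) • x)⟫_ℂ = a := by
  have hx' : (‖x‖ : ℂ) ≠ 0 := by exact_mod_cast norm_ne_zero_iff.2 hx
  rw [map_smul, inner_smul_left, inner_smul_right, h, inner_self_eq_norm_sq_to_K,
    Complex.conj_ofReal]
  push_cast
  field_simp
  exact mul_comm _ _

theorem inner_smul_add_smul_adjoint {E : Type*} [NormedAddCommGroup E] [InnerProductSpace ℂ E]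
    [CompleteSpace E] (T : E →L[ℂ] E) (c d : ℂ) (x : E) :
    ⟪x, (c • T + d • ContinuousLinearMap.adjoint T) x⟫_ℂ =
      c * ⟪x, T x⟫_ℂ + d * conj ⟪x, T x⟫_ℂ := by
  simp only [add_apply, smul_apply, inner_add_right, inner_smul_right,
    ContinuousLinearMap.adjoint_inner_right, inner_conj_symm]

/-- The sum factors as c (1 + (d/c) C) A, and the middle factor is invertible by a Neumann series.
-/
theorem isUnit_smul_add_smul_iff {E : Type*} [NormedAddCommGroup E] [NormedSpace ℂ E]
    [CompleteSpace E] {A B C : E →L[ℂ] E} {c d : ℂ} (hC : ‖C‖ ≤ 1) (hB : B = C * A)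
    (hcd : ‖d‖ < ‖c‖) : IsUnit (c • A + d • B) ↔ IsUnit A := by
  have hc : 0 < ‖c‖ := (norm_nonneg d).trans_lt hcd
  have hc0 : c ≠ 0 := norm_pos_iff.1 hc
  have hu : IsUnit (1 - (-(d / c)) • C) := by
    refine isUnit_one_sub_of_norm_lt_one ?_
    rw [norm_smul, norm_neg, norm_div]
    exact (mul_le_of_le_one_right (by positivity) hC).trans_lt ((div_lt_one hc).2 hcd)
  have hfac : c • A + d • B = c • ((1 - (-(d / c)) • C) * A) := by
    rw [hB, sub_mul, one_mul, neg_smul, neg_mul, sub_neg_eq_add, smul_add,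
      smul_mul_assoc, smul_smul, mul_div_cancel₀ _ hc0]
  rw [hfac, isUnit_smul_iff_of_ne_zero hc0]
  exact hu.mul_left_iff

theorem isUnit_adjoint_iff {E : Type*} [NormedAddCommGroup E] [InnerProductSpace ℂ E]
    [CompleteSpace E] (T : E →L[ℂ] E) : IsUnit (ContinuousLinearMap.adjoint T) ↔ IsUnit T := by
  rw [← ContinuousLinearMap.star_eq_adjoint, isUnit_star]

/-- Ensures that replacing `c` by (1+η)c strictly increases its modulus. -/
theorem left_ne_zero_of_isUnit_smul_add_smul {R : Type*} [Ring R] [Algebra ℂ R] [Nontrivial R]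
    {a b : R} {c d : ℂ} (hcd : ‖d‖ ≤ ‖c‖) (h : IsUnit (c • a + d • b)) : c ≠ 0 := by
  rintro rfl
  have hd : d = 0 := by simpa using hcd
  rw [hd, zero_smul, zero_smul, add_zero] at h
  exact not_isUnit_zero h

/-- If `c T + d T*` is invertible, then so are all small shifts of it with `c` slightly
increased. -/
theorem exists_isUnit_shift_of_isUnit {E : Type*} [NormedAddCommGroup E] [InnerProductSpace ℂ E]
    [CompleteSpace E] {T : E →L[ℂ] E} {c d : ℂ}
    (h : IsUnit (c • T + d • ContinuousLinearMap.adjoint T)) :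
    ∃ δ : ℝ, 0 < δ ∧ ∀ a : ℂ, ‖c * a + d * conj a‖ < δ → ∃ η : ℝ, 0 < η ∧
      IsUnit (((1 + η : ℝ) * c : ℂ) • (T - a • 1) +
        d • ContinuousLinearMap.adjoint (T - a • 1)) := by
  obtain ⟨ε, hε, hball⟩ := Metric.isOpen_iff.1 Units.isOpen _ h
  -- Half of the radius ε pays for the shift by `a`, the other half for the enlargement of `c`.
  refine ⟨ε / 2, half_pos hε, fun a ha => ?_⟩
  set A₀ := T - a • (1 : E →L[ℂ] E) with hA₀
  set η : ℝ := ε / 2 / (‖c • A₀‖ + 1)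
  have hη : 0 < η := by positivity
  have hηA : η * ‖c • A₀‖ < ε / 2 := by
    rw [div_mul_eq_mul_div, div_lt_iff₀ (by positivity)]
    nlinarith
  refine ⟨η, hη, hball ?_⟩
  -- The shift enters only through the scalar c a + d ā, which for a = g(z) is the symbol at z.
  have e1 : ((1 + η : ℝ) * c : ℂ) • A₀ + d • ContinuousLinearMap.adjoint A₀ -
      (c • T + d • ContinuousLinearMap.adjoint T) =
      (η : ℂ) • (c • A₀) - (c * a + d * conj a) • (1 : E →L[ℂ] E) := by
    have e2 : ContinuousLinearMap.adjoint A₀ = ContinuousLinearMap.adjoint T - conj a • 1 := by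
      rw [hA₀, ← ContinuousLinearMap.star_eq_adjoint, ← ContinuousLinearMap.star_eq_adjoint,
        star_sub, star_smul, star_one]
      rfl
    rw [e2, show ((1 + η : ℝ) * c : ℂ) • A₀ = c • A₀ + (η : ℂ) • (c • A₀) by
      push_cast; module]
    nth_rewrite 1 [hA₀]
    module
  have h1 : ‖(1 : E →L[ℂ] E)‖ ≤ 1 := ContinuousLinearMap.norm_id_le
  rw [mem_ball, dist_eq_norm, e1]
  refine (norm_sub_le _ _).trans_lt ?_
  rw [norm_smul, norm_smul (c * a + _), Complex.norm_real, Real.norm_of_nonneg hη.le]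
  nlinarith [mul_le_mul_of_nonneg_left h1 (norm_nonneg (c * a + d * conj a))]

/-! ### Bounded analytic symbols -/

theorem IsHInfty.memLp {g : ℂ → ℂ} (hg : IsHInfty g) : MemLp g ∞ areaMeasure :=
  memLp_of_continuousOn_disc hg.1.continuousOn hg.2.choose_spec

theorem IsHInfty.mul {f g : ℂ → ℂ} (hf : IsHInfty f) (hg : IsHInfty g) :
    IsHInfty fun w => f w * g w := by
  obtain ⟨hfd, M, hM⟩ := hf
  obtain ⟨hgd, N, hN⟩ := hg
  refine ⟨hfd.mul hgd, M * N, fun w hw => ?_⟩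
  rw [norm_mul]
  exact mul_le_mul (hM w hw) (hN w hw) (norm_nonneg _) ((norm_nonneg _).trans (hM w hw))

theorem IsHInfty.sub_const {g : ℂ → ℂ} (hg : IsHInfty g) (a : ℂ) :
    IsHInfty fun w => g w - a := by
  obtain ⟨hgd, M, hM⟩ := hg
  exact ⟨hgd.sub_const a, M + ‖a‖, fun w hw =>
    (norm_sub_le _ _).trans (by gcongr; exact hM w hw)⟩

theorem isHInfty_bergmanKernel {z : ℂ} (hz : z ∈ disc) :
    IsHInfty fun w : ℂ => 1 / (1 - conj z * w) ^ 2 := by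
  have hz' : ‖z‖ < 1 := by simpa [disc] using hz
  refine ⟨differentiableOn_bergmanKernel hz, 1 / (1 - ‖z‖) ^ 2, fun w hw => ?_⟩
  have := one_sub_norm_le_norm_one_sub z hw
  have h0 : 0 < 1 - ‖z‖ := by linarith
  rw [norm_div, norm_one, norm_pow]
  gcongr

/-- The Toeplitz operator with bounded analytic symbol `g`. -/
noncomputable def analyticToeplitz {g : ℂ → ℂ} (hg : IsHInfty g) :
    bergmanSpace →L[ℂ] bergmanSpace :=
  toeplitz (hg.memLp.toLp g)

theorem coeFn_analyticToeplitz {g : ℂ → ℂ} (hg : IsHInfty g) (f : bergmanSpace) :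
    (analyticToeplitz hg f : Lp ℂ 2 areaMeasure) =ᵐ[areaMeasure]
      fun w => g w * (f : Lp ℂ 2 areaMeasure) w :=
  coeFn_toeplitz_of_analytic hg.1 hg.memLp.coeFn_toLp f

/-! ### Reproducing kernels and the Berezin transform -/

theorem coeFn_bergmanKernel (z : disc) :
    (bergmanKernel z : Lp ℂ 2 areaMeasure) =ᵐ[areaMeasure]
      fun w => 1 / (1 - conj (z : ℂ) * w) ^ 2 :=
  (memLp_bergmanKernel z.2).coeFn_toLp

/-- The reproducing property is applied to g K_z and to K_z. Both are bounded, so its version for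
bounded functions suffices. -/
theorem inner_bergmanKernel_analyticToeplitz {g : ℂ → ℂ} (hg : IsHInfty g) (z : disc) :
    ⟪bergmanKernel z, analyticToeplitz hg (bergmanKernel z)⟫_ℂ =
      g z * ⟪bergmanKernel z, bergmanKernel z⟫_ℂ := by
  have h1 := integral_conj_bergmanKernel_mul (hg.mul (isHInfty_bergmanKernel z.2)) z.2
  have h2 := integral_conj_bergmanKernel_mul (isHInfty_bergmanKernel z.2) z.2
  rw [Submodule.coe_inner, Submodule.coe_inner, L2.inner_def, L2.inner_def]
  refine Eq.trans (integral_congr_ae ?_) (h1.trans (congrArg _ (Eq.trans h2.symm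
    (integral_congr_ae ?_))))
  · filter_upwards [coeFn_bergmanKernel z, coeFn_analyticToeplitz hg (bergmanKernel z)]
      with w h3 h4
    rw [h4, h3, RCLike.inner_apply, mul_comm]
  · filter_upwards [coeFn_bergmanKernel z] with w h3
    rw [h3, RCLike.inner_apply, mul_comm]

theorem bergmanKernel_ne_zero (z : disc) : bergmanKernel z ≠ 0 := by
  intro h
  have h2 := integral_conj_bergmanKernel_mul (isHInfty_bergmanKernel z.2) z.2
  have h3 : ∫ w, conj (1 / (1 - conj (z : ℂ) * w) ^ 2) * (1 / (1 - conj (z : ℂ) * w) ^ 2)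
      ∂areaMeasure = 0 := by
    refine integral_eq_zero_of_ae ?_
    have h4 := coeFn_bergmanKernel z
    rw [h] at h4
    filter_upwards [h4, Lp.coeFn_zero ℂ 2 areaMeasure] with w h5 h6
    rw [← h5]
    simp
  rw [h3] at h2
  have hz := one_sub_norm_le_norm_one_sub (z : ℂ) z.2
  have hz' : ‖(z : ℂ)‖ < 1 := by simpa [disc] using z.2
  exact div_ne_zero one_ne_zero (pow_ne_zero 2 (norm_pos_iff.1 (by linarith))) h2.symm

theorem inner_normalizedKernel_analyticToeplitz {g : ℂ → ℂ} (hg : IsHInfty g) (z : disc) :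
    ⟪normalizedKernel z, analyticToeplitz hg (normalizedKernel z)⟫_ℂ = g z :=
  inner_normalized_eq (bergmanKernel_ne_zero z) (inner_bergmanKernel_analyticToeplitz hg z)

theorem toeplitz_symbol {g : ℂ → ℂ} (hg : IsHInfty g) (c d : ℂ) :
    toeplitz ((hg.memLp_symbol c d).toLp (symbol g c d)) =
      c • analyticToeplitz hg + d • ContinuousLinearMap.adjoint (analyticToeplitz hg) := by
  set φ := hg.memLp.toLp g
  have hstar : (star φ : Lp ℂ ∞ areaMeasure) =ᵐ[areaMeasure] fun w => conj (φ w) :=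
    Lp.coeFn_star φ
  rw [analyticToeplitz, adjoint_toeplitz hstar, ← toeplitz_smul, ← toeplitz_smul, ← toeplitz_add]
  -- The two classes agree definitionally.
  congr 1

theorem berezin_symbol {g : ℂ → ℂ} (hg : IsHInfty g) (c d : ℂ) (z : disc) :
    berezin ((hg.memLp_symbol c d).toLp (symbol g c d)) z = symbol g c d z := by
  rw [berezin, toeplitz_symbol hg]
  refine (inner_smul_add_smul_adjoint (analyticToeplitz hg) c d _).trans ?_
  rw [inner_normalizedKernel_analyticToeplitz, symbol]

/-! ### Shifts, inverses and adjoints of analytic Toeplitz operators -/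

theorem analyticToeplitz_sub_const {g : ℂ → ℂ} (hg : IsHInfty g) (a : ℂ) :
    analyticToeplitz (hg.sub_const a) = analyticToeplitz hg - a • 1 := by
  ext1 f
  refine Subtype.ext (Lp.ext ?_)
  have h : (((analyticToeplitz hg - a • 1) f : bergmanSpace) : Lp ℂ 2 areaMeasure) =
      (analyticToeplitz hg f : Lp ℂ 2 areaMeasure) - a • (f : Lp ℂ 2 areaMeasure) := rfl
  rw [h]
  filter_upwards [coeFn_analyticToeplitz hg f, coeFn_analyticToeplitz (hg.sub_const a) f,
    Lp.coeFn_sub (analyticToeplitz hg f : Lp ℂ 2 areaMeasure) (a • (f : Lp ℂ 2 areaMeasure)),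
    Lp.coeFn_smul a (f : Lp ℂ 2 areaMeasure)] with w h1 h2 h3 h4
  rw [h2, h3, Pi.sub_apply, h1, h4, Pi.smul_apply, smul_eq_mul, sub_mul]

theorem eqOn_disc_of_ae_eq {F G : ℂ → ℂ} (hF : ContinuousOn F disc) (hG : ContinuousOn G disc)
    (h : F =ᵐ[areaMeasure] G) : EqOn F G disc := by
  have h1 : F =ᵐ[(volume : Measure ℂ).restrict disc] G := by
    refine (Measure.ae_ennreal_smul_measure_iff ?_).1 h
    exact ENNReal.inv_ne_zero.2 ENNReal.ofReal_ne_top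
  exact Measure.eqOn_open_of_ae_eq h1 isOpen_ball hF hG

/-- Surjectivity puts the constant 1 = K_0 in the range, so g F = 1 almost everywhere for some
analytic F, hence everywhere on the disc by continuity. -/
theorem ne_zero_of_isUnit_analyticToeplitz {g : ℂ → ℂ} (hg : IsHInfty g)
    (h : IsUnit (analyticToeplitz hg)) {z : ℂ} (hz : z ∈ disc) : g z ≠ 0 := by
  obtain ⟨B, hB⟩ := h.exists_right_inv
  set k := bergmanKernel ⟨0, mem_ball_self one_pos⟩
  obtain ⟨F, hF, hfF⟩ := (B k).2
  have h1 : analyticToeplitz hg (B k) = k := by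
    rw [← mul_apply_eq_comp, hB, one_apply_eq_self]
  have h2 := coeFn_analyticToeplitz hg (B k)
  rw [h1] at h2
  have h3 : (fun w => g w * F w) =ᵐ[areaMeasure] fun _ => (1 : ℂ) := by
    filter_upwards [h2, hfF, coeFn_bergmanKernel ⟨0, mem_ball_self one_pos⟩] with w h4 h5 h6
    rw [← h5, ← h4, h6]
    simp
  have h4 := eqOn_disc_of_ae_eq (hg.1.mul hF).continuousOn continuousOn_const h3 hz
  exact left_ne_zero_of_mul_eq_one h4

theorem isUnit_analyticToeplitz_of_le {g : ℂ → ℂ} (hg : IsHInfty g) {δ : ℝ} (hδ : 0 < δ)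
    (h : ∀ z ∈ disc, δ ≤ ‖g z‖) : IsUnit (analyticToeplitz hg) := by
  have h0 : ∀ z ∈ disc, g z ≠ 0 := fun z hz => norm_pos_iff.1 (hδ.trans_le (h z hz))
  have hi : IsHInfty fun z => (g z)⁻¹ := by
    refine ⟨hg.1.inv h0, δ⁻¹, fun z hz => ?_⟩
    rw [norm_inv]
    exact inv_anti₀ hδ (h z hz)
  set e : Lp ℂ ∞ areaMeasure := (memLp_const (1 : ℂ)).toLp _
  have he : e =ᵐ[areaMeasure] fun _ => (1 : ℂ) := MemLp.coeFn_toLp _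
  have h1 : analyticToeplitz hg * analyticToeplitz hi = 1 := by
    rw [← toeplitz_eq_one he]
    refine toeplitz_mul_toeplitz_of_analytic hi.1 hi.memLp.coeFn_toLp ?_
    filter_upwards [he, hg.memLp.coeFn_toLp, ae_areaMeasure_mem_disc] with w h2 h3 hw
    rw [h2, h3, mul_inv_cancel₀ (h0 w hw)]
  have h2 : analyticToeplitz hi * analyticToeplitz hg = 1 := by
    rw [← toeplitz_eq_one he]
    refine toeplitz_mul_toeplitz_of_analytic hg.1 hg.memLp.coeFn_toLp ?_
    filter_upwards [he, hi.memLp.coeFn_toLp, ae_areaMeasure_mem_disc] with w h2 h3 hw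
    rw [h2, h3, inv_mul_cancel₀ (h0 w hw)]
  exact ⟨⟨_, _, h1, h2⟩, rfl⟩

/-- The adjoint of an analytic Toeplitz operator factors through it by a contraction: the Toeplitz
operator with symbol `ḡ / g`. -/
theorem exists_adjoint_analyticToeplitz_eq {g : ℂ → ℂ} (hg : IsHInfty g) :
    ∃ C : bergmanSpace →L[ℂ] bergmanSpace, ‖C‖ ≤ 1 ∧
      ContinuousLinearMap.adjoint (analyticToeplitz hg) = C * analyticToeplitz hg := by
  set φ := hg.memLp.toLp g
  have hφ : φ =ᵐ[areaMeasure] g := hg.memLp.coeFn_toLp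
  -- At zeros of `g` the quotient is 0 by convention, so the bound holds everywhere.
  have hb : ∀ w, ‖conj (g w) / g w‖ ≤ 1 := fun w => by
    rw [norm_div, RCLike.norm_conj]
    exact div_self_le_one _
  have hmeas : AEStronglyMeasurable (fun w => conj (g w) / g w) areaMeasure := by
    have h1 := hg.memLp.aestronglyMeasurable.aemeasurable
    exact ((Complex.continuous_conj.measurable.comp_aemeasurable h1).div h1).aestronglyMeasurable
  have hψ : MemLp (fun w => conj (g w) / g w) ∞ areaMeasure :=
    MemLp.of_bound hmeas 1 (Eventually.of_forall hb)
  refine ⟨toeplitz (hψ.toLp _), (norm_toeplitz_le _).trans ?_, ?_⟩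
  · have h := Lp.norm_le_of_ae_bound (f := hψ.toLp _) zero_le_one ?_
    · simpa using h
    filter_upwards [hψ.coeFn_toLp] with w hw
    rw [hw]
    exact hb w
  · have hstar : (star φ : Lp ℂ ∞ areaMeasure) =ᵐ[areaMeasure] fun w => conj (φ w) :=
      Lp.coeFn_star φ
    rw [analyticToeplitz, adjoint_toeplitz hstar]
    refine (toeplitz_mul_toeplitz_of_analytic hg.1 hφ ?_).symm
    filter_upwards [hstar, hψ.coeFn_toLp, hφ] with w h1 h2 h3
    rw [h1, h2, h3]
    by_cases h0 : g w = 0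
    · simp [h0]
    · rw [div_mul_cancel₀ _ h0]

theorem isUnit_symbol_iff_of_norm_lt {g : ℂ → ℂ} (hg : IsHInfty g) {c d : ℂ} (hcd : ‖d‖ < ‖c‖) :
    IsUnit (c • analyticToeplitz hg + d • ContinuousLinearMap.adjoint (analyticToeplitz hg)) ↔
      IsUnit (analyticToeplitz hg) := by
  obtain ⟨C, hC, h⟩ := exists_adjoint_analyticToeplitz_eq hg
  exact isUnit_smul_add_smul_iff hC h hcd

/-! ### Invertibility -/

theorem conj_symbol (g : ℂ → ℂ) (c d z : ℂ) :
    conj (symbol g c d z) = symbol g (conj d) (conj c) z := by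
  simp only [symbol, map_add, map_mul, Complex.conj_conj]
  ring

theorem norm_symbol_swap (g : ℂ → ℂ) (c d z : ℂ) :
    ‖symbol g (conj d) (conj c) z‖ = ‖symbol g c d z‖ := by
  rw [← conj_symbol, RCLike.norm_conj]

/-- The two operators are adjoint to each other; this reduces everything to |d| ≤ |c|. -/
theorem isUnit_toeplitz_symbol_swap {g : ℂ → ℂ} (hg : IsHInfty g) (c d : ℂ) :
    IsUnit (toeplitz ((hg.memLp_symbol (conj d) (conj c)).toLp (symbol g (conj d) (conj c)))) ↔
      IsUnit (toeplitz ((hg.memLp_symbol c d).toLp (symbol g c d))) := by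
  rw [← adjoint_toeplitz (φ := (hg.memLp_symbol c d).toLp (symbol g c d))]
  · exact isUnit_adjoint_iff _
  filter_upwards [(hg.memLp_symbol (conj d) (conj c)).coeFn_toLp,
    (hg.memLp_symbol c d).coeFn_toLp] with w h1 h2
  rw [h1, h2, conj_symbol]

/-! ### From a lower bound on the symbol to invertibility -/

theorem norm_symbol_le {g : ℂ → ℂ} {c d z : ℂ} (hcd : ‖d‖ ≤ ‖c‖) :
    ‖symbol g c d z‖ ≤ 2 * ‖c‖ * ‖g z‖ := by
  refine (norm_add_le _ _).trans ?_
  rw [norm_mul, norm_mul, RCLike.norm_conj]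
  nlinarith [mul_le_mul_of_nonneg_right hcd (norm_nonneg (g z))]

theorem isUnit_toeplitz_symbol_of_norm_lt {g : ℂ → ℂ} (hg : IsHInfty g) {c d : ℂ}
    (hcd : ‖d‖ < ‖c‖) {δ : ℝ} (hδ : 0 < δ) (h : ∀ z ∈ disc, δ ≤ ‖symbol g c d z‖) :
    IsUnit (toeplitz ((hg.memLp_symbol c d).toLp (symbol g c d))) := by
  have hc : 0 < ‖c‖ := (norm_nonneg d).trans_lt hcd
  rw [toeplitz_symbol hg, isUnit_symbol_iff_of_norm_lt hg hcd]
  refine isUnit_analyticToeplitz_of_le hg (δ := δ / (2 * ‖c‖)) (by positivity) fun z hz => ?_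
  rw [div_le_iff₀' (by positivity)]
  exact (h z hz).trans (norm_symbol_le hcd.le)

theorem isPreconnected_disc : IsPreconnected disc :=
  (convex_ball (0 : ℂ) 1).isPreconnected

/-- A change of sign would force a zero, by the intermediate value theorem on the connected disc. -/
theorem forall_le_or_forall_le_neg_of_le_abs {u : ℂ → ℝ} (hu : ContinuousOn u disc) {δ : ℝ}
    (hδ : 0 < δ) (h : ∀ z ∈ disc, δ ≤ |u z|) :
    (∀ z ∈ disc, δ ≤ u z) ∨ ∀ z ∈ disc, δ ≤ -u z := by
  by_contra! hcon
  obtain ⟨⟨z, hz, h1⟩, w, hw, h2⟩ := hcon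
  have h3 : u z ≤ 0 := by
    rcases le_abs'.1 (h z hz) with h4 | h4 <;> linarith
  have h4 : 0 ≤ u w := by
    rcases le_abs'.1 (h w hw) with h4 | h4 <;> linarith
  obtain ⟨x, hx, hx0⟩ := isPreconnected_disc.intermediate_value hz hw hu ⟨h3, h4⟩
  have := h x hx
  rw [hx0, abs_zero] at this
  linarith

theorem isUnit_toeplitz_symbol_of_norm_eq {g : ℂ → ℂ} (hg : IsHInfty g) {c d : ℂ}
    (hcd : ‖d‖ = ‖c‖) {δ : ℝ} (hδ : 0 < δ) (h : ∀ z ∈ disc, δ ≤ ‖symbol g c d z‖) :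
    IsUnit (toeplitz ((hg.memLp_symbol c d).toLp (symbol g c d))) := by
  have hc : c ≠ 0 := by
    rintro rfl
    have h0 := (h 0 (mem_ball_self one_pos)).trans (norm_symbol_le hcd.le)
    simp at h0
    linarith
  have hd : d ≠ 0 := norm_ne_zero_iff.1 (hcd ▸ norm_ne_zero_iff.2 hc)
  -- This `s` is unimodular with s d the conjugate of s c, so s φ = 2 Re(s c g) is real.
  obtain ⟨s, hs⟩ := IsAlgClosed.exists_pow_nat_eq (conj c / d) (n := 2) two_pos
  have hs1 : ‖s‖ = 1 := by
    have : ‖s‖ ^ 2 = 1 := by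
      rw [← norm_pow, hs, norm_div, RCLike.norm_conj, hcd, div_self (norm_ne_zero_iff.2 hc)]
    exact (pow_eq_one_iff_of_nonneg (norm_nonneg _) two_ne_zero).1 this
  have hs0 : s ≠ 0 := norm_ne_zero_iff.1 (by rw [hs1]; exact one_ne_zero)
  have hsd : s * d = conj (s * c) := by
    have h1 : conj s * s = 1 := by rw [mul_comm, Complex.mul_conj', hs1]; simp
    calc s * d = conj s * (s ^ 2 * d) := by rw [sq]; linear_combination (-(s * d)) * h1
      _ = conj (s * c) := by rw [hs, div_mul_cancel₀ _ hd, map_mul]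
  set u : ℂ → ℝ := fun z => 2 * (s * c * g z).re with hu
  have hsu : ∀ z, s * symbol g c d z = (u z : ℂ) := by
    intro z
    rw [hu, symbol, mul_add, ← mul_assoc, ← mul_assoc, hsd, ← map_mul, Complex.add_conj]
  have huabs : ∀ z, |u z| = ‖symbol g c d z‖ := by
    intro z
    rw [← Real.norm_eq_abs, ← Complex.norm_real, ← hsu, norm_mul, hs1, one_mul]
  have hucont : ContinuousOn u disc :=
    continuousOn_const.mul (Complex.continuous_re.comp_continuousOn
      (continuousOn_const.mul hg.1.continuousOn))
  obtain ⟨M, hM⟩ := hg.2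
  have hule : ∀ z ∈ disc, |u z| ≤ 2 * ‖c‖ * M := fun z hz => by
    rw [huabs]
    refine (norm_symbol_le hcd.le).trans ?_
    gcongr
    exact hM z hz
  set φ := (hg.memLp_symbol c d).toLp (symbol g c d)
  have hφ : φ =ᵐ[areaMeasure] symbol g c d := (hg.memLp_symbol c d).coeFn_toLp
  rcases forall_le_or_forall_le_neg_of_le_abs hucont hδ fun z hz => (huabs z).symm ▸ h z hz
    with hpos | hneg
  · rw [← isUnit_smul_iff_of_ne_zero hs0, ← toeplitz_smul]
    refine isUnit_toeplitz_of_real hδ ?_ fun z hz =>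
      ⟨hpos z hz, (le_abs_self _).trans (hule z hz)⟩
    filter_upwards [Lp.coeFn_smul s φ, hφ] with w h1 h2
    rw [h1, Pi.smul_apply, h2, smul_eq_mul, hsu]
  · rw [← isUnit_smul_iff_of_ne_zero (neg_ne_zero.2 hs0),
      ← toeplitz_smul]
    refine isUnit_toeplitz_of_real hδ (u := fun z => -u z) ?_ fun z hz =>
      ⟨hneg z hz, (neg_le_abs _).trans (hule z hz)⟩
    filter_upwards [Lp.coeFn_smul (-s) φ, hφ] with w h1 h2
    rw [h1, Pi.smul_apply, h2, smul_eq_mul, neg_mul, hsu, Complex.ofReal_neg]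

theorem isUnit_toeplitz_symbol_of_le {g : ℂ → ℂ} (hg : IsHInfty g) (c d : ℂ) {δ : ℝ}
    (hδ : 0 < δ) (h : ∀ z ∈ disc, δ ≤ ‖symbol g c d z‖) :
    IsUnit (toeplitz ((hg.memLp_symbol c d).toLp (symbol g c d))) := by
  rcases lt_trichotomy ‖d‖ ‖c‖ with hcd | hcd | hcd
  · exact isUnit_toeplitz_symbol_of_norm_lt hg hcd hδ h
  · exact isUnit_toeplitz_symbol_of_norm_eq hg hcd hδ h
  · rw [← isUnit_toeplitz_symbol_swap hg]
    refine isUnit_toeplitz_symbol_of_norm_lt hg (by simpa using hcd) hδ fun z hz => ?_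
    rw [norm_symbol_swap]
    exact h z hz

/-! ### From invertibility to a lower bound on the symbol -/

theorem exists_le_norm_symbol_of_isUnit_of_norm_le {g : ℂ → ℂ} (hg : IsHInfty g) {c d : ℂ}
    (hcd : ‖d‖ ≤ ‖c‖) (h : IsUnit (toeplitz ((hg.memLp_symbol c d).toLp (symbol g c d)))) :
    ∃ δ : ℝ, 0 < δ ∧ ∀ z ∈ disc, δ ≤ ‖symbol g c d z‖ := by
  rw [toeplitz_symbol hg] at h
  have : Nontrivial bergmanSpace := ⟨_, _, bergmanKernel_ne_zero ⟨0, mem_ball_self one_pos⟩⟩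
  have hc : c ≠ 0 := left_ne_zero_of_isUnit_smul_add_smul hcd h
  obtain ⟨δ, hδ, hshift⟩ := exists_isUnit_shift_of_isUnit h
  refine ⟨δ, hδ, fun z hz => ?_⟩
  by_contra! hlt
  -- Shifting by g(z) makes the analytic symbol vanish at z; enlarging `c` makes |d| < |c| strict,
  -- also when |d| = |c|.
  obtain ⟨η, hη, hunit⟩ := hshift (g z) hlt
  rw [← analyticToeplitz_sub_const hg] at hunit
  have hlt' : ‖d‖ < ‖((1 + η : ℝ) * c : ℂ)‖ := by
    rw [norm_mul, Complex.norm_real, Real.norm_of_nonneg (by positivity)]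
    nlinarith [mul_pos hη (norm_pos_iff.2 hc)]
  exact ne_zero_of_isUnit_analyticToeplitz _ ((isUnit_symbol_iff_of_norm_lt _ hlt').1 hunit) hz
    (sub_self _)

theorem exists_le_norm_symbol_of_isUnit {g : ℂ → ℂ} (hg : IsHInfty g) (c d : ℂ)
    (h : IsUnit (toeplitz ((hg.memLp_symbol c d).toLp (symbol g c d)))) :
    ∃ δ : ℝ, 0 < δ ∧ ∀ z ∈ disc, δ ≤ ‖symbol g c d z‖ := by
  rcases le_total ‖d‖ ‖c‖ with hcd | hcd
  · exact exists_le_norm_symbol_of_isUnit_of_norm_le hg hcd h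
  · obtain ⟨δ, hδ, hle⟩ := exists_le_norm_symbol_of_isUnit_of_norm_le hg
      (c := conj d) (d := conj c) (by simpa using hcd) ((isUnit_toeplitz_symbol_swap hg c d).2 h)
    exact ⟨δ, hδ, fun z hz => norm_symbol_swap g c d z ▸ hle z hz⟩

theorem mainTheorem1 (g : ℂ → ℂ) (hg : IsHInfty g) (c d : ℂ) :
    List.TFAE
      [IsUnit (toeplitz ((hg.memLp_symbol c d).toLp (symbol g c d))),
        ∃ δ : ℝ, 0 < δ ∧ ∀ z ∈ disc, δ ≤ ‖symbol g c d z‖,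
        0 < ⨅ z : disc, ‖symbol g c d z‖,
        0 < ⨅ z : disc, ‖berezin ((hg.memLp_symbol c d).toLp (symbol g c d)) z‖] ∧
    (∀ z : disc, berezin ((hg.memLp_symbol c d).toLp (symbol g c d)) z = symbol g c d z) ∧
    (⨅ z : disc, ‖berezin ((hg.memLp_symbol c d).toLp (symbol g c d)) z‖) =
      ⨅ z : disc, ‖symbol g c d z‖ := by
  have hinf : (⨅ z : disc, ‖berezin ((hg.memLp_symbol c d).toLp (symbol g c d)) z‖) =
      ⨅ z : disc, ‖symbol g c d z‖ := by
    simp only [berezin_symbol hg]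
  refine ⟨?_, berezin_symbol hg c d, hinf⟩
  rw [hinf]
  tfae_have 1 → 2 := exists_le_norm_symbol_of_isUnit hg c d
  tfae_have 2 → 1 := fun ⟨_, hδ, h⟩ => isUnit_toeplitz_symbol_of_le hg c d hδ h
  tfae_have 2 → 3 := fun ⟨δ, hδ, h⟩ => by
    have : Nonempty disc := ⟨⟨0, mem_ball_self one_pos⟩⟩
    exact hδ.trans_le (le_ciInf fun z => h z z.2)
  tfae_have 3 → 2 := fun h => ⟨_, h, fun z hz =>
    ciInf_le (f := fun z : disc => ‖symbol g c d z‖)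
      ⟨0, forall_mem_range.2 fun _ => norm_nonneg _⟩ ⟨z, hz⟩⟩
  -- After `rw [hinf]` the two entries are the same proposition.
  tfae_have 3 ↔ 4 := Iff.rfl
  tfae_finish
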